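/- \textbf{Setting.} There are $n\ge 1$ agents; agent $i$ has a unit interval $I_i=[s_i,s_i+1]\subset\mathbb{R}$ and reports its left endpoint $s_i$. A covering interval $C=[c,c+1]$ has to be placed. The cost of agent $i$ is $\mathrm{cost}_i(C)=|I_i\setminus (I_i\cap C)|$ (Lebesgue measure) and the social cost is $\mathrm{SC}(C)=\sum_i \mathrm{cost}_i(C)$. A deterministic mechanism maps the vector of reports to a position $c\in\mathbb{R}$; it is truthful if no agent can lower her cost by misreporting, whatever the reports of the others. A randomized mechanism maps the reports to a probability distribution over positions; it is universally truthful if its output is obtained by drawing a random seed independently of the reports and running a deterministic mechanism depending on the seed, this deterministic mechanism being truthful for every seed. The approximation ratio (for $n$ agents) is the supremum, over all instances with $n$ agents, of the (expected) social cost of the output divided by $\min_C \mathrm{SC}(C)$, where $0/0$ counts as $0$ and $a/0$ as $\infty$ for $a>0$. The Uniform-Statistic mechanism sorts the agents by their reported left endpoints and places the covering interval exactly at the interval of the $\lceil n/3\rceil$-th, the median (that is, the $\lfloor n/2\rfloor$-th), and the $\lceil 2n/3\rceil$-th leftmost agent, each with probability $1/3$ (for $n=1$ all three are the only agent). \textbf{Theorem.}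 For every $n\ge 1$: (a) Uniform-Statistic is universally truthful; (b) the approximation ratio of Uniform-Statistic is at most $5/3$; (c) if $n>6$ is even, or if $n>11$, then every deterministic truthful mechanism for $n$ agents has approximation ratio strictly larger than $5/3$, so Uniform-Statistic outperforms all of them. -/

import Mathlib

open MeasureTheory Set
open scoped ENNReal

namespace TIC

noncomputable section

/-- The unit interval `[x, x + 1]` with left endpoint `x`. -/
def unitInterval (x : ℝ) : Set ℝ := Icc x (x + 1)

/-- The cost of an agent with interval `[x, x + 1]` when the covering interval is `[c, c + 1]`:
the length of the part of her interval that is not covered. -/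
def cost (x c : ℝ) : ℝ≥0∞ :=
  volume (unitInterval x \ (unitInterval x ∩ unitInterval c))

/-- An instance with `n` agents: agent `i` has the interval `[s i, s i + 1]`.  The agents keep
their identities, so the vector need not be sorted. -/
abbrev Instance (n : ℕ) : Type := Fin n → ℝ

/-- The social cost of the covering interval `[c, c + 1]`. -/
def socialCost {n : ℕ} (s : Instance n) (c : ℝ) : ℝ≥0∞ := ∑ i, cost (s i) c

/-- The smallest social cost of a covering interval. -/
def optCost {n : ℕ} (s : Instance n) : ℝ≥0∞ := ⨅ c : ℝ, socialCost s c

/-- A deterministic mechanism maps the reports to the left endpoint of the covering interval. -/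
abbrev Mechanism (n : ℕ) : Type := Instance n → ℝ

/-- A randomized mechanism maps the reports to a probability distribution over positions. -/
abbrev RandomizedMechanism (n : ℕ) : Type := Instance n → ProbabilityMeasure ℝ

/-- No agent can decrease her cost by misreporting her interval. -/
def Truthful {n : ℕ} (M : Mechanism n) : Prop :=
  ∀ (s : Instance n) (i : Fin n) (s' : ℝ),
    cost (s i) (M s) ≤ cost (s i) (M (Function.update s i s'))

/-- The mechanism runs a deterministic mechanism that depends on a random seed `ω`, chosen
independently of the reports, and for every seed that deterministic mechanism is truthful. -/
def UniversallyTruthful {n : ℕ} (R : RandomizedMechanism n) : Prop :=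
  ∃ (Ω : Type) (_ : MeasurableSpace Ω) (μ : Measure Ω) (_ : IsProbabilityMeasure μ)
    (M : Ω → Mechanism n),
    (∀ ω, Truthful (M ω)) ∧
    ∀ s : Instance n, Measurable (fun ω => M ω s) ∧
      (R s : Measure ℝ) = μ.map (fun ω => M ω s)

/-- Approximation ratio of a deterministic mechanism on instances with `n` agents.  In `ℝ≥0∞`
one has `0 / 0 = 0` and `a / 0 = ∞` for `a ≠ 0`. -/
def approxRatio {n : ℕ} (M : Mechanism n) : ℝ≥0∞ :=
  ⨆ s : Instance n, socialCost s (M s) / optCost s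

/-- The expected social cost of a randomized mechanism. -/
def expectedSocialCost {n : ℕ} (R : RandomizedMechanism n) (s : Instance n) : ℝ≥0∞ :=
  ∫⁻ c, socialCost s c ∂(R s : Measure ℝ)

/-- Approximation ratio of a randomized mechanism on instances with `n` agents. -/
def randomizedApproxRatio {n : ℕ} (R : RandomizedMechanism n) : ℝ≥0∞ :=
  ⨆ s : Instance n, expectedSocialCost R s / optCost s

/-- The ordered statistic mechanism: it outputs the interval of the agent in position `k`
(counted from `0`) when the agents are sorted by their reported left endpoints. -/
def orderedStatistic {n : ℕ} (k : Fin n) : Mechanism n := fun s => s (Tuple.sort s k)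

/-- The positions, counted from `0`, of the `⌈n/3⌉`-th, the median (`⌊n/2⌋`-th) and the
`⌈2n/3⌉`-th leftmost agent.  For `n = 1` all three are the only agent. -/
def statisticIndex (n : ℕ) (hn : 0 < n) : Fin 3 → Fin n :=
  ![⟨(n + 2) / 3 - 1, by omega⟩, ⟨n / 2 - 1, by omega⟩, ⟨(2 * n + 2) / 3 - 1, by omega⟩]

/-- Uniform-Statistic: it places the covering interval at the interval of each of the three
agents above with probability `1/3`. -/
def uniformStatistic (n : ℕ) (hn : 0 < n) : RandomizedMechanism n := fun s =>
  ⟨((PMF.uniformOfFintype (Fin 3)).map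
      (fun j => orderedStatistic (statisticIndex n hn j) s)).toMeasure, inferInstance⟩

end

end TIC

/-! An agent's cost is her distance to the outcome truncated at 1 (`cost_eq`).

Upper bound: fix a competitor `o`. Moving from `o` to a statistic on its right hurts only agents
left of that statistic, by amounts that split into layers between consecutive statistics; the agents
beyond a layer pay for it already at `o`. The three increases thus sum to at most twice the cost at
`o` incurred on the right (`sum_rightGain_le`). Reflection treats the left, so the three outcomes
together cost at most 3 + 2 = 5 times `o`.

Lower bound: let a truthful mechanism be within 5/3, and let `S` be a smallest coalition that can
impose a point `c` on the others gathered nearby; it has at most ⌈n/2⌉ members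
(`exists_decisive_card_le`). Keep one member at `c`, and spread the other members almost 1 to one
side and the complement almost 1 to the other. The outcome stays at `c`: leaving it would make a
smaller coalition decisive or break the ratio. Now `c` costs almost n - 1 while the complement's
position costs at most |S|, so |S| is about 3n/5 or more (`card_bound_of_decisive`), too many for
large n. -/

namespace TIC

/-! ### Costs as truncated distances -/

/-- The distance of two unit intervals, truncated at `1`: the real value of `cost`. -/
noncomputable def truncDist (x c : ℝ) : ℝ := min 1 |x - c|

lemma truncDist_nonneg (x c : ℝ) : 0 ≤ truncDist x c := le_min zero_le_one (abs_nonneg _)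

lemma truncDist_le_one (x c : ℝ) : truncDist x c ≤ 1 := min_le_left _ _

lemma truncDist_le_abs (x c : ℝ) : truncDist x c ≤ |x - c| := min_le_right _ _

lemma truncDist_self (x : ℝ) : truncDist x x = 0 := by simp [truncDist]

lemma truncDist_neg (x c : ℝ) : truncDist (-x) (-c) = truncDist x c := by
  unfold truncDist; rw [← abs_neg]; congr 2; ring

lemma truncDist_comm (x c : ℝ) : truncDist x c = truncDist c x := by
  unfold truncDist; rw [abs_sub_comm]

lemma truncDist_triangle (x y z : ℝ) : truncDist x z ≤ truncDist x y + truncDist y z := by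
  have h := abs_sub_le x y z
  have h1 := abs_nonneg (x - y)
  have h2 := abs_nonneg (y - z)
  unfold truncDist
  rcases min_cases 1 |x - y| with h3 | h3 <;> rcases min_cases 1 |y - z| with h4 | h4 <;>
    rcases min_cases 1 |x - z| with h5 | h5 <;> linarith

lemma truncDist_le_truncDist {x c x' c' : ℝ} (h : |x - c| ≤ |x' - c'|) :
    truncDist x c ≤ truncDist x' c' := min_le_min le_rfl h

lemma cost_eq (x c : ℝ) : cost x c = ENNReal.ofReal (truncDist x c) := by
  unfold cost unitInterval truncDist
  rw [Set.sdiff_self_inter]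
  rcases le_total x c with h | h
  · rw [abs_of_nonpos (by linarith)]
    rcases le_total c (x + 1) with h' | h'
    · have : Icc x (x + 1) \ Icc c (c + 1) = Ico x c := by
        ext z; simp only [mem_sdiff, mem_Icc, mem_Ico, not_and, not_le]
        constructor
        · rintro ⟨⟨h1, h2⟩, h3⟩
          refine ⟨h1, ?_⟩
          by_contra! h4
          linarith [h3 h4]
        · rintro ⟨h1, h2⟩
          exact ⟨⟨h1, by linarith⟩, fun h3 => by linarith⟩
      rw [this, Real.volume_Ico, min_eq_right (by linarith)]
      congr 1; ring
    · rw [min_eq_left (by linarith)]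
      apply le_antisymm
      · refine (measure_mono sdiff_subset).trans ?_
        rw [Real.volume_Icc]; apply ENNReal.ofReal_le_ofReal; linarith
      · have : Ico x (x + 1) ⊆ Icc x (x + 1) \ Icc c (c + 1) := by
          intro z hz
          exact ⟨⟨hz.1, hz.2.le⟩, fun h3 => by linarith [h3.1, hz.2]⟩
        refine le_trans ?_ (measure_mono this)
        rw [Real.volume_Ico]; apply ENNReal.ofReal_le_ofReal; linarith
  · rw [abs_of_nonneg (by linarith)]
    rcases le_total x (c + 1) with h' | h'
    · have : Icc x (x + 1) \ Icc c (c + 1) = Ioc (c + 1) (x + 1) := by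
        ext z; simp only [mem_sdiff, mem_Icc, mem_Ioc, not_and, not_le]
        constructor
        · rintro ⟨⟨h1, h2⟩, h3⟩
          exact ⟨h3 (by linarith), h2⟩
        · rintro ⟨h1, h2⟩
          exact ⟨⟨by linarith, by linarith⟩, fun h3 => by linarith⟩
      rw [this, Real.volume_Ioc, min_eq_right (by linarith)]
      congr 1; ring
    · rw [min_eq_left (by linarith)]
      apply le_antisymm
      · refine (measure_mono sdiff_subset).trans ?_
        rw [Real.volume_Icc]; apply ENNReal.ofReal_le_ofReal; linarith
      · have : Ioc x (x + 1) ⊆ Icc x (x + 1) \ Icc c (c + 1) := by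
          intro z hz
          exact ⟨⟨hz.1.le, hz.2⟩, fun h3 => by linarith [h3.2, hz.1]⟩
        refine le_trans ?_ (measure_mono this)
        rw [Real.volume_Ioc]; apply ENNReal.ofReal_le_ofReal; linarith

lemma cost_le_cost_iff {x c x' c' : ℝ} :
    cost x c ≤ cost x' c' ↔ truncDist x c ≤ truncDist x' c' := by
  rw [cost_eq, cost_eq, ENNReal.ofReal_le_ofReal_iff (truncDist_nonneg _ _)]

/-- The real value of `socialCost`. -/
noncomputable def totalDist {n : ℕ} (s : Instance n) (c : ℝ) : ℝ := ∑ i, truncDist (s i) c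

lemma totalDist_nonneg {n : ℕ} (s : Instance n) (c : ℝ) : 0 ≤ totalDist s c :=
  Finset.sum_nonneg fun _ _ => truncDist_nonneg _ _

lemma socialCost_eq {n : ℕ} (s : Instance n) (c : ℝ) :
    socialCost s c = ENNReal.ofReal (totalDist s c) := by
  unfold socialCost totalDist
  rw [ENNReal.ofReal_sum_of_nonneg fun _ _ => truncDist_nonneg _ _]
  exact Finset.sum_congr rfl fun _ _ => cost_eq _ _

lemma totalDist_neg {n : ℕ} (s : Instance n) (c : ℝ) :
    totalDist (fun i => -s i) (-c) = totalDist s c :=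
  Finset.sum_congr rfl fun _ _ => truncDist_neg _ _

lemma truthful_iff {n : ℕ} {M : Mechanism n} :
    Truthful M ↔ ∀ (s : Instance n) (i : Fin n) (s' : ℝ),
      truncDist (s i) (M s) ≤ truncDist (s i) (M (Function.update s i s')) := by
  simp only [Truthful, cost_le_cost_iff]

/-! ### Order statistics and universal truthfulness -/

lemma card_lt_orderedStatistic {n : ℕ} (k : Fin n) (s : Instance n) :
    (Finset.univ.filter fun i => s i < orderedStatistic k s).card ≤ k := by
  have hm := Tuple.monotone_sort s
  rw [← Finset.card_map (Tuple.sort s).symm.toEmbedding]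
  calc _ ≤ (Finset.Iio k).card := by
        apply Finset.card_le_card
        intro p hp
        rw [Finset.mem_map_equiv, Equiv.symm_symm] at hp
        rw [Finset.mem_Iio]
        by_contra! h
        exact absurd (Finset.mem_filter.1 hp).2 (not_lt.2 (hm h))
    _ = k := by simp

lemma lt_card_le_orderedStatistic {n : ℕ} (k : Fin n) (s : Instance n) :
    (k : ℕ) < (Finset.univ.filter fun i => s i ≤ orderedStatistic k s).card := by
  have hm := Tuple.monotone_sort s
  rw [← Finset.card_map (Tuple.sort s).symm.toEmbedding]
  calc (k : ℕ) < (Finset.Iic k).card := by simp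
    _ ≤ _ := by
        apply Finset.card_le_card
        intro p hp
        rw [Finset.mem_map_equiv, Equiv.symm_symm]
        exact Finset.mem_filter.2 ⟨Finset.mem_univ _, hm (Finset.mem_Iic.1 hp)⟩

/-- By the two counts above, a misreport by an agent left of the outcome can only push it further
right, away from her; symmetrically on the other side. -/
lemma orderedStatistic_truthful {n : ℕ} (k : Fin n) : Truthful (orderedStatistic k) := by
  rw [truthful_iff]
  intro s i s'
  set t := Function.update s i s' with ht
  have hts : ∀ j, j ≠ i → t j = s j := fun j hj => Function.update_of_ne hj _ _
  rcases lt_trichotomy (s i) (orderedStatistic k s) with h | h | h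
  · have : orderedStatistic k s ≤ orderedStatistic k t := by
      by_contra! hlt
      have h1 := lt_card_le_orderedStatistic k t
      have h2 := card_lt_orderedStatistic k s
      refine absurd (h1.trans_le (Finset.card_le_card ?_)) (not_lt.2 h2)
      intro j hj
      simp only [Finset.mem_filter, Finset.mem_univ, true_and] at hj ⊢
      rcases eq_or_ne j i with rfl | hji
      · exact h
      · rw [hts j hji] at hj; exact hj.trans_lt hlt
    apply truncDist_le_truncDist
    rw [abs_of_neg (by linarith), abs_of_neg (by linarith)]; linarith
  · rw [← h, truncDist_self]; exact truncDist_nonneg _ _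
  · have : orderedStatistic k t ≤ orderedStatistic k s := by
      by_contra! hlt
      have h1 := lt_card_le_orderedStatistic k s
      have h2 := card_lt_orderedStatistic k t
      refine absurd (h1.trans_le (Finset.card_le_card ?_)) (not_lt.2 h2)
      intro j hj
      simp only [Finset.mem_filter, Finset.mem_univ, true_and] at hj ⊢
      rcases eq_or_ne j i with rfl | hji
      · linarith
      · rw [hts j hji]; exact hj.trans_lt hlt
    apply truncDist_le_truncDist
    rw [abs_of_pos (by linarith), abs_of_pos (by linarith)]; linarith

lemma uniformStatistic_universallyTruthful (n : ℕ) (hn : 0 < n) :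
    UniversallyTruthful (uniformStatistic n hn) := by
  refine ⟨Fin 3, inferInstance, (PMF.uniformOfFintype (Fin 3)).toMeasure, inferInstance,
    fun j => orderedStatistic (statisticIndex n hn j), fun j => orderedStatistic_truthful _,
    fun s => ⟨measurable_of_finite _, ?_⟩⟩
  exact (PMF.toMeasure_map _ _ (measurable_of_finite _)).symm

lemma measurable_socialCost {n : ℕ} (s : Instance n) : Measurable (socialCost s) := by
  have : socialCost s = fun c => ENNReal.ofReal (∑ i, min 1 |s i - c|) :=
    funext fun c => socialCost_eq s c
  rw [this]
  exact (Continuous.measurable (by fun_prop)).ennreal_ofReal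

lemma expectedSocialCost_uniformStatistic (n : ℕ) (hn : 0 < n) (s : Instance n) :
    expectedSocialCost (uniformStatistic n hn) s =
      ENNReal.ofReal
        ((∑ j, totalDist s (orderedStatistic (statisticIndex n hn j) s)) / 3) := by
  have h : (uniformStatistic n hn s : Measure ℝ) = ((PMF.uniformOfFintype (Fin 3)).toMeasure).map
      (fun j => orderedStatistic (statisticIndex n hn j) s) :=
    (PMF.toMeasure_map _ _ (measurable_of_finite _)).symm
  unfold expectedSocialCost
  rw [h, lintegral_map (measurable_socialCost s) (measurable_of_finite _), lintegral_fintype,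
    Finset.sum_div, ENNReal.ofReal_sum_of_nonneg
      fun _ _ => div_nonneg (totalDist_nonneg _ _) (by norm_num)]
  refine Finset.sum_congr rfl fun j _ => ?_
  rw [PMF.toMeasure_apply_singleton _ _ (measurableSet_singleton _), PMF.uniformOfFintype_apply,
    socialCost_eq, ENNReal.ofReal_div_of_pos (by norm_num), div_eq_mul_inv]
  simp

/-! ### The ratio 5/3 of Uniform-Statistic -/

/-- The truncated distance of `z` from `o` if `z` lies to the right of `o`, and `0` otherwise. -/
noncomputable def rightDist (o z : ℝ) : ℝ := if o < z then truncDist z o else 0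

lemma rightDist_nonneg (o z : ℝ) : 0 ≤ rightDist o z := by
  unfold rightDist; split_ifs
  · exact truncDist_nonneg _ _
  · exact le_rfl

lemma rightDist_mono (o : ℝ) : Monotone (rightDist o) := by
  intro a b hab
  unfold rightDist; split_ifs with h1 h2
  · apply truncDist_le_truncDist
    rw [abs_of_pos (by linarith), abs_of_pos (by linarith)]; linarith
  · linarith
  · exact truncDist_nonneg _ _
  · exact le_rfl

lemma truncDist_sub_le_rightDist {o y : ℝ} (h : o < y) (z : ℝ) :
    truncDist z y - truncDist z o ≤ rightDist o y := by
  rw [rightDist, if_pos h]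
  have := truncDist_triangle z o y
  rw [truncDist_comm y o]; linarith

/-- For `o < q` the whole segment from `z` to `y` lies right of `o`, so `z` is no farther from `y`
than `o` is, and at least as far from `o` as `q` is. -/
lemma truncDist_sub_le_sub {o y z q : ℝ} (h : o < y) (hq : q ≤ z) (hz : z ≤ y) :
    truncDist z y - truncDist z o ≤ rightDist o y - rightDist o q := by
  by_cases hoq : o < q
  · rw [rightDist, rightDist, if_pos h, if_pos hoq]
    have h1 : truncDist z y ≤ truncDist y o := by
      apply truncDist_le_truncDist
      rw [abs_of_nonpos (by linarith), abs_of_pos (by linarith)]; linarith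
    have h2 : truncDist q o ≤ truncDist z o := by
      apply truncDist_le_truncDist
      rw [abs_of_pos (by linarith), abs_of_pos (by linarith)]; linarith
    linarith
  · have := truncDist_sub_le_rightDist h z
    rw [show rightDist o q = 0 from if_neg hoq]; linarith

lemma truncDist_sub_nonpos {o y z : ℝ} (h : o < y) (hz : y ≤ z) :
    truncDist z y - truncDist z o ≤ 0 := by
  rw [sub_nonpos]
  apply truncDist_le_truncDist
  rw [abs_of_nonneg (by linarith), abs_of_pos (by linarith)]; linarith

/-- The increase of the total distance when moving from `o` to `y`, if `y` is to the right. -/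
noncomputable def rightGain {n : ℕ} (x : Instance n) (o y : ℝ) : ℝ :=
  if o < y then totalDist x y - totalDist x o else 0

lemma sum_ite_lt {n : ℕ} (k : Fin n) : (∑ i : Fin n, if i < k then (1 : ℝ) else 0) = (k : ℕ) := by
  rw [Finset.sum_boole, Finset.filter_gt_eq_Iio]; simp

/-- An agent before `c` is charged relative to the last of `a`, `b` at or before her; agents from
`c` on lose nothing. The final subtracted term, saved by agent `c` herself, is indispensable: for
odd `n ≥ 3` the mirrored median condition holds with equality. -/
lemma rightGain_le {n : ℕ} {x : Instance n} (hx : Monotone x) (o : ℝ) {a b c : Fin n}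
    (hab : a ≤ b) (hbc : b ≤ c) :
    rightGain x o (x c) ≤ rightDist o (x a) * (a : ℕ) +
      (rightDist o (x b) - rightDist o (x a)) * (b : ℕ) +
      (rightDist o (x c) - rightDist o (x b)) * (c : ℕ) - rightDist o (x c) := by
  have hta := rightDist_nonneg o (x a)
  have htab := rightDist_mono o (hx hab)
  have htbc := rightDist_mono o (hx hbc)
  by_cases h : o < x c
  · rw [rightGain, if_pos h, totalDist, totalDist, ← Finset.sum_sub_distrib]
    calc _ ≤ ∑ i, (rightDist o (x a) * (if i < a then (1 : ℝ) else 0) +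
          (rightDist o (x b) - rightDist o (x a)) * (if i < b then (1 : ℝ) else 0) +
          (rightDist o (x c) - rightDist o (x b)) * (if i < c then (1 : ℝ) else 0) -
          (if i = c then rightDist o (x c) else 0)) := by
          apply Finset.sum_le_sum
          intro i _
          rcases lt_or_ge i c with hic | hci
          · rw [if_pos hic, if_neg hic.ne]
            rcases lt_or_ge i b with hib | hbi
            · rw [if_pos hib]
              rcases lt_or_ge i a with hia | hai
              · rw [if_pos hia]
                linarith [truncDist_sub_le_rightDist h (x i)]
              · rw [if_neg hai.not_gt]
                linarith [truncDist_sub_le_sub h (hx hai) (hx hic.le)]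
            · rw [if_neg hbi.not_gt, if_neg (hab.trans hbi).not_gt]
              linarith [truncDist_sub_le_sub h (hx hbi) (hx hic.le)]
          · rw [if_neg hci.not_gt, if_neg (hbc.trans hci).not_gt,
              if_neg (hab.trans (hbc.trans hci)).not_gt]
            split_ifs with hic
            · subst hic
              rw [truncDist_self, rightDist, rightDist, rightDist, if_pos h]; linarith
            · linarith [truncDist_sub_nonpos h (hx hci)]
      _ = _ := by
          rw [Finset.sum_sub_distrib, Finset.sum_add_distrib, Finset.sum_add_distrib,
            ← Finset.mul_sum, ← Finset.mul_sum, ← Finset.mul_sum, sum_ite_lt, sum_ite_lt,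
            sum_ite_lt, Finset.sum_ite_eq' Finset.univ c, if_pos (Finset.mem_univ _)]
  · have h0 : rightDist o (x c) = 0 := if_neg h
    have h1 : rightDist o (x b) = 0 := by linarith
    have h2 : rightDist o (x a) = 0 := by linarith
    rw [rightGain, if_neg h, h0, h1, h2]; simp

/-- Layer-cake bound: each increment is contained in the distance of every agent from that position
on. -/
lemma le_sum_rightDist {n : ℕ} {x : Instance n} (hx : Monotone x) (o : ℝ) {a b c : Fin n}
    (hab : a ≤ b) (hbc : b ≤ c) :
    rightDist o (x a) * (n - (a : ℕ)) +
      (rightDist o (x b) - rightDist o (x a)) * (n - (b : ℕ)) +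
      (rightDist o (x c) - rightDist o (x b)) * (n - (c : ℕ)) ≤ ∑ i, rightDist o (x i) := by
  have hm : ∀ {i j : Fin n}, i ≤ j → rightDist o (x i) ≤ rightDist o (x j) :=
    fun h => rightDist_mono o (hx h)
  have hs : ∀ k : Fin n,
      ((n : ℝ) - (k : ℕ)) = ∑ i : Fin n, (1 - if i < k then (1 : ℝ) else 0) := by
    intro k
    rw [Finset.sum_sub_distrib, sum_ite_lt]; simp
  rw [hs, hs, hs, Finset.mul_sum, Finset.mul_sum, Finset.mul_sum, ← Finset.sum_add_distrib,
    ← Finset.sum_add_distrib]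
  apply Finset.sum_le_sum
  intro i _
  have h0 := rightDist_nonneg o (x i)
  have hab' := hm hab
  have hbc' := hm hbc
  rcases lt_or_ge i a with hia | hai
  · rw [if_pos hia, if_pos (hia.trans_le hab), if_pos (hia.trans_le (hab.trans hbc))]; linarith
  · rw [if_neg hai.not_gt]
    rcases lt_or_ge i b with hib | hbi
    · rw [if_pos hib, if_pos (hib.trans_le hbc)]; linarith [hm hai]
    · rw [if_neg hbi.not_gt]
      rcases lt_or_ge i c with hic | hci
      · rw [if_pos hic]; linarith [hm hbi]
      · rw [if_neg hci.not_gt]; linarith [hm hci]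

/-- The coefficients of the three increments of `rightDist` are 3(a - 1), 2(b - 1) and c - 1 in the
gains, against 2(n - a), 2(n - b) and 2(n - c) on the right; the hypotheses compare exactly these.
-/
lemma sum_rightGain_le {n : ℕ} {x : Instance n} (hx : Monotone x) (o : ℝ) {a b c : Fin n}
    (hab : a ≤ b) (hbc : b ≤ c) (ha : 5 * (a : ℕ) ≤ 2 * n + 3) (hb : 4 * (b : ℕ) ≤ 2 * n + 2)
    (hc : 3 * (c : ℕ) ≤ 2 * n + 1) :
    rightGain x o (x a) + rightGain x o (x b) + rightGain x o (x c) ≤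
      2 * ∑ i, rightDist o (x i) := by
  have h1 := rightGain_le hx o (le_refl a) (le_refl a)
  have h2 := rightGain_le hx o hab (le_refl b)
  have h3 := rightGain_le hx o hab hbc
  have h4 := le_sum_rightDist hx o hab hbc
  have ha' : 5 * ((a : ℕ) : ℝ) ≤ 2 * n + 3 := by exact_mod_cast ha
  have hb' : 4 * ((b : ℕ) : ℝ) ≤ 2 * n + 2 := by exact_mod_cast hb
  have hc' : 3 * ((c : ℕ) : ℝ) ≤ 2 * n + 1 := by exact_mod_cast hc
  have e1 := mul_nonneg (rightDist_nonneg o (x a)) (sub_nonneg.2 ha')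
  have e2 := mul_nonneg (sub_nonneg.2 (rightDist_mono o (hx hab))) (sub_nonneg.2 hb')
  have e3 := mul_nonneg (sub_nonneg.2 (rightDist_mono o (hx hbc))) (sub_nonneg.2 hc')
  linarith

/-- The primed hypotheses are the unprimed ones for the reflected instance, where position `i`
becomes `n - 1 - i` and `a`, `c` swap roles. -/
lemma sum_totalDist_le {n : ℕ} {x : Instance n} (hx : Monotone x) (o : ℝ) {a b c : Fin n}
    (hab : a ≤ b) (hbc : b ≤ c) (ha : 5 * (a : ℕ) ≤ 2 * n + 3) (hb : 4 * (b : ℕ) ≤ 2 * n + 2)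
    (hc : 3 * (c : ℕ) ≤ 2 * n + 1) (ha' : 3 * n ≤ 3 * (a : ℕ) + 2 * n + 4)
    (hb' : 4 * n ≤ 4 * (b : ℕ) + 2 * n + 6) (hc' : 5 * n ≤ 5 * (c : ℕ) + 2 * n + 8) :
    totalDist x (x a) + totalDist x (x b) + totalDist x (x c) ≤ 5 * totalDist x o := by
  have h1 := sum_rightGain_le hx o hab hbc ha hb hc
  set x' : Instance n := fun i => -x (Fin.rev i) with hx'
  have hmx' : Monotone x' := fun i j hij => neg_le_neg (hx (Fin.rev_le_rev.2 hij))
  have hrev : ∀ i, x' (Fin.rev i) = -x i := fun i => by simp [hx']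
  have htot : ∀ y, totalDist x' (-y) = totalDist x y := by
    intro y
    rw [← totalDist_neg x y]
    exact Equiv.sum_comp Fin.revPerm fun i => truncDist (-x i) (-y)
  have h2 := sum_rightGain_le hmx' (-o) (Fin.rev_le_rev.2 hbc) (Fin.rev_le_rev.2 hab)
    (by rw [Fin.val_rev]; omega) (by rw [Fin.val_rev]; omega) (by rw [Fin.val_rev]; omega)
  rw [hrev, hrev, hrev] at h2
  have hg : ∀ y, rightGain x o y + rightGain x' (-o) (-y) = totalDist x y - totalDist x o := by
    intro y
    unfold rightGain
    rw [htot, htot]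
    rcases lt_trichotomy o y with h | h | h
    · rw [if_pos h, if_neg (by linarith)]; ring
    · subst h; simp
    · rw [if_neg h.not_gt, if_pos (by linarith)]; ring
  have hs : ∑ i, rightDist o (x i) + ∑ i, rightDist (-o) (x' i) ≤ totalDist x o := by
    rw [show ∑ i, rightDist (-o) (x' i) = ∑ i, rightDist (-o) (-x i) from
      Equiv.sum_comp Fin.revPerm fun i => rightDist (-o) (-x i), ← Finset.sum_add_distrib]
    apply Finset.sum_le_sum
    intro i _
    unfold rightDist
    rw [truncDist_neg]
    have := truncDist_nonneg (x i) o
    split_ifs <;> linarith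
  linarith [hg (x a), hg (x b), hg (x c)]

lemma totalDist_comp_perm {n : ℕ} (s : Instance n) (σ : Equiv.Perm (Fin n)) (c : ℝ) :
    totalDist (s ∘ σ) c = totalDist s c :=
  Equiv.sum_comp σ fun i => truncDist (s i) c

lemma randomizedApproxRatio_uniformStatistic_le (n : ℕ) (hn : 0 < n) :
    randomizedApproxRatio (uniformStatistic n hn) ≤ 5 / 3 := by
  -- This direction needs no case split for a zero optimum, and the infimum need not be attained:
  -- any `o` serves as competitor.
  refine iSup_le fun s => ENNReal.div_le_of_le_mul ?_
  rw [optCost, ENNReal.mul_iInf_of_ne (by simp) (by finiteness)]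
  refine le_iInf fun o => ?_
  rw [expectedSocialCost_uniformStatistic, socialCost_eq,
    show (5 / 3 : ℝ≥0∞) = ENNReal.ofReal (5 / 3) by
      rw [ENNReal.ofReal_div_of_pos (by norm_num)]; simp,
    ← ENNReal.ofReal_mul (by norm_num)]
  apply ENNReal.ofReal_le_ofReal
  have hm := Tuple.monotone_sort s
  have := sum_totalDist_le hm o (a := statisticIndex n hn 0) (b := statisticIndex n hn 1)
    (c := statisticIndex n hn 2)
    (by simp [statisticIndex]; omega) (by simp [statisticIndex]; omega)
    (by simp [statisticIndex]; omega) (by simp [statisticIndex]; omega)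
    (by simp [statisticIndex]; omega) (by simp [statisticIndex]; omega)
    (by simp [statisticIndex]; omega) (by simp [statisticIndex]; omega)
  simp only [totalDist_comp_perm, Function.comp_apply] at this
  simp only [Fin.sum_univ_three, orderedStatistic]
  linarith

/-! ### Group deviations under truthfulness -/

/-- The profile where the agents in `A` report `a` and all others report as in `s`. -/
def moveTo {n : ℕ} (A : Finset (Fin n)) (a : ℝ) (s : Instance n) : Instance n :=
  fun i => if i ∈ A then a else s i

lemma moveTo_of_mem {n : ℕ} {A : Finset (Fin n)} {a : ℝ} {s : Instance n} {i : Fin n}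
    (h : i ∈ A) : moveTo A a s i = a := if_pos h

lemma moveTo_of_notMem {n : ℕ} {A : Finset (Fin n)} {a : ℝ} {s : Instance n} {i : Fin n}
    (h : i ∉ A) : moveTo A a s i = s i := if_neg h

lemma moveTo_insert {n : ℕ} (A : Finset (Fin n)) (a : ℝ) (s : Instance n) (i : Fin n) :
    moveTo (insert i A) a s = Function.update (moveTo A a s) i a := by
  ext j
  rcases eq_or_ne j i with rfl | h
  · simp [moveTo]
  · simp [moveTo, h]

/-- To move a group of agents to `a`, move them one after the other. -/
lemma moveTo_induction {n : ℕ} (P : Instance n → Prop) (A : Finset (Fin n)) (a : ℝ)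
    (s : Instance n) (h0 : P s)
    (step : ∀ B ⊆ A, ∀ i ∈ A, i ∉ B → P (moveTo B a s) →
      P (Function.update (moveTo B a s) i a)) : P (moveTo A a s) := by
  suffices h : ∀ B ⊆ A, P (moveTo B a s) from h A subset_rfl
  intro B
  induction B using Finset.induction_on with
  | empty =>
    intro _
    convert h0 using 1
    ext j; simp [moveTo]
  | insert i B hi ih =>
    intro hB
    rw [moveTo_insert]
    have hB' : B ⊆ A := (Finset.subset_insert i B).trans hB
    exact step B hB' i (hB (Finset.mem_insert_self _ _)) hi (ih hB')

lemma truncDist_lt_truncDist {x c x' c' : ℝ} (h : |x - c| < |x' - c'|) (h1 : |x - c| < 1) :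
    truncDist x c < truncDist x' c' := (truncDist_le_abs x c).trans_lt (lt_min h1 h)

lemma abs_le_of_truncDist_le {x c x' c' : ℝ} (h : truncDist x c ≤ truncDist x' c')
    (h1 : |x' - c'| < 1) : |x - c| ≤ |x' - c'| := by
  by_contra! h2
  exact absurd (truncDist_lt_truncDist h2 h1) (not_lt.2 h)

namespace Truthful

variable {n : ℕ} {M : Mechanism n}

lemma le_before (hM : Truthful M) (s : Instance n) (i : Fin n) (q : ℝ) :
    truncDist (s i) (M s) ≤ truncDist (s i) (M (Function.update s i q)) :=
  truthful_iff.1 hM s i q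

lemma le_after (hM : Truthful M) (s : Instance n) (i : Fin n) (q : ℝ) :
    truncDist q (M (Function.update s i q)) ≤ truncDist q (M s) := by
  have := truthful_iff.1 hM (Function.update s i q) i (s i)
  simpa using this

/-- An agent whose true point is `c` could restore the outcome `c`, at cost zero, by undoing her
move. -/
lemma moveTo_outcome (hM : Truthful M) (A : Finset (Fin n)) {s : Instance n} {c : ℝ}
    (hs : M s = c) : M (moveTo A c s) = c := by
  refine moveTo_induction (fun t => M t = c) A c s hs fun B _ i _ _ h => ?_
  have h2 := hM.le_after (moveTo B c s) i c
  rw [h, truncDist_self] at h2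
  have h3 := abs_le_of_truncDist_le (x' := 0) (c' := 0)
    (h2.trans (truncDist_nonneg 0 0)) (by simp)
  simp only [sub_self, abs_zero, abs_nonpos_iff] at h3
  linarith

/-- A mover at `q` cannot lose, so a changed outcome would lie in `(c, 2q - c]`, strictly nearer
than `c` to her old point: a profitable lie. -/
lemma moveTo_toward (hM : Truthful M) {A : Finset (Fin n)} {s : Instance n} {c q : ℝ}
    (hs : M s = c) (hq : c < q) (hA : ∀ i ∈ A, q < s i ∧ s i < c + 1) :
    M (moveTo A q s) = c := by
  refine moveTo_induction (fun t => M t = c) A q s hs fun B _ i hi hiB h => ?_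
  have h1 := hM.le_before (moveTo B q s) i q
  have h2 := hM.le_after (moveTo B q s) i q
  rw [h] at h1 h2
  rw [moveTo_of_notMem hiB] at h1
  obtain ⟨h3, h4⟩ := hA i hi
  set o := M (Function.update (moveTo B q s) i q)
  have h5 := abs_le_of_truncDist_le h2 (by rw [abs_of_pos] <;> linarith)
  rw [abs_of_pos (by linarith : 0 < q - c), abs_le] at h5
  by_contra hne
  have hlt : c < o := lt_of_le_of_ne (by linarith) (Ne.symm hne)
  have h6 : |s i - o| < |s i - c| := by
    rw [abs_of_pos (by linarith : 0 < s i - c), abs_lt]; constructor <;> linarith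
  refine absurd (truncDist_lt_truncDist h6 (h6.trans ?_)) (not_lt.2 h1)
  rw [abs_of_pos] <;> linarith

/-- Agents that move to the right, but not past the outcome, cannot pull it to their left. -/
lemma moveTo_push (hM : Truthful M) {A : Finset (Fin n)} {s : Instance n} {q : ℝ}
    (hq : q < M s) (hq' : M s < q + 1) (hA : ∀ i ∈ A, s i ≤ q ∧ q < s i + 1) :
    q < M (moveTo A q s) ∧ M (moveTo A q s) ≤ M s := by
  refine moveTo_induction (fun t => q < M t ∧ M t ≤ M s) A q s ⟨hq, le_rfl⟩
    fun B _ i hi hiB ⟨ha, hb⟩ => ?_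
  have h1 := hM.le_before (moveTo B q s) i q
  have h2 := hM.le_after (moveTo B q s) i q
  rw [moveTo_of_notMem hiB] at h1
  obtain ⟨h3, h4⟩ := hA i hi
  rcases h3.eq_or_lt with h3 | h3
  · have : Function.update (moveTo B q s) i q = moveTo B q s := by
      rw [Function.update_eq_self_iff, moveTo_of_notMem hiB, h3]
    rw [this]; exact ⟨ha, hb⟩
  set o := M (moveTo B q s)
  set o' := M (Function.update (moveTo B q s) i q)
  have h5 := abs_le_of_truncDist_le h2 (by rw [abs_of_neg] <;> linarith)
  rw [abs_of_neg (by linarith : q - o < 0), abs_le] at h5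
  refine ⟨?_, by linarith⟩
  -- An outcome in `[2q - o, q]` would be closer than `o` to `s i < q`.
  by_contra! hle
  refine absurd (truncDist_lt_truncDist ?_ ?_) (not_lt.2 h1)
  · rw [abs_of_neg (by linarith : s i - o < 0), abs_lt]; constructor <;> linarith
  · rw [abs_lt]; constructor <;> linarith

end Truthful

/-! ### Decisive coalitions and moving the complement outwards -/

/-- The agents in `S`, all reporting the same point, determine the outcome against all other
agents, who report another point at distance less than `1`. -/
def Decisive {n : ℕ} (M : Mechanism n) (S : Finset (Fin n)) : Prop :=
  ∃ c q : ℝ, c ≠ q ∧ |c - q| < 1 ∧ M (moveTo S c fun _ => q) = c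

section expand

variable {n : ℕ} {M : Mechanism n} {T R : Finset (Fin n)} {s : Instance n} {c w : ℝ}

/-- If the outcome leaves `c`, truthfulness at the old point sends it to `c + 2w` or beyond, past `c
+ w'`. Everybody outside `T` can then gather at `c + w'` behind it, and `T` can join the outcome,
making `T` decisive. -/
lemma outcome_expand_of_lt_two_mul (hM : Truthful M) (hT : ¬ Decisive M T)
    (hR : ∀ i ∈ R, s i = c + w) (hc : ∀ i, i ∉ T → i ∉ R → s i = c)
    (hs : M s = c) {w' : ℝ} (hw : 0 < w) (hww' : w < w') (hw2 : w' < 2 * w) (hw1 : w' < 1) :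
    M (moveTo R (c + w') s) = c := by
  refine moveTo_induction (fun t => M t = c) R (c + w') s hs fun B hB i hi hiB h => ?_
  have h1 := hM.le_before (moveTo B (c + w') s) i (c + w')
  have h2 := hM.le_after (moveTo B (c + w') s) i (c + w')
  rw [h] at h1 h2
  rw [moveTo_of_notMem hiB, hR i hi] at h1
  set t := Function.update (moveTo B (c + w') s) i (c + w') with ht
  have h3 := abs_le_of_truncDist_le h2 (by rw [abs_of_pos] <;> linarith)
  rw [abs_of_pos (by linarith : 0 < c + w' - c), abs_le] at h3
  by_contra hne
  have hlt : c < M t := lt_of_le_of_ne (by linarith) (Ne.symm hne)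
  have hge : c + 2 * w ≤ M t := by
    by_contra! hlt'
    have : |c + w - M t| < w := by rw [abs_lt]; constructor <;> linarith
    refine absurd (truncDist_lt_truncDist ?_ (this.trans (by linarith))) (not_lt.2 h1)
    rwa [add_sub_cancel_left, abs_of_pos hw]
  have hpush := hM.moveTo_push (A := Tᶜ) (s := t) (q := c + w') (by linarith) (by linarith) (by
    intro j hj
    rw [Finset.mem_compl] at hj
    have : t j = c ∨ t j = c + w ∨ t j = c + w' := by
      rw [ht, ← moveTo_insert]
      by_cases hjB : j ∈ insert i B
      · right; right; exact moveTo_of_mem hjB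
      · rw [moveTo_of_notMem hjB]
        by_cases hjR : j ∈ R
        · right; left; exact hR j hjR
        · left; exact hc j hj hjR
    rcases this with h | h | h <;> rw [h] <;> constructor <;> linarith)
  refine hT ⟨M (moveTo Tᶜ (c + w') t), c + w', hpush.1.ne', ?_, ?_⟩
  · rw [abs_lt]; constructor <;> linarith
  · convert hM.moveTo_outcome T (s := moveTo Tᶜ (c + w') t) rfl using 2
    ext j
    by_cases hj : j ∈ T <;> simp [moveTo, hj]

lemma moveTo_moveTo {n : ℕ} (A : Finset (Fin n)) (a b : ℝ) (s : Instance n) :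
    moveTo A a (moveTo A b s) = moveTo A a s := by
  ext i; by_cases h : i ∈ A <;> simp [moveTo, h]

lemma moveTo_eq_self {n : ℕ} {A : Finset (Fin n)} {a : ℝ} {s : Instance n}
    (h : ∀ i ∈ A, s i = a) : moveTo A a s = s := by
  ext i; by_cases hi : i ∈ A <;> simp [moveTo, hi, h]

/-- Each step may stretch by any factor below 2; the factor 3/2 is iterated. -/
lemma outcome_expand (hM : Truthful M) (hT : ¬ Decisive M T)
    (hR : ∀ i ∈ R, s i = c + w) (hc : ∀ i, i ∉ T → i ∉ R → s i = c)
    (hs : M s = c) (hw : 0 < w) {v : ℝ} (hwv : w ≤ v) (hv : v < 1) :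
    M (moveTo R (c + v) s) = c := by
  have key : ∀ (N : ℕ) (v : ℝ), w ≤ v → v < 1 → v ≤ w * (3 / 2) ^ N →
      M (moveTo R (c + v) s) = c := by
    intro N
    induction N with
    | zero =>
      intro v h1 _ h3
      have : v = w := by rw [pow_zero, mul_one] at h3; linarith
      rw [moveTo_eq_self (by rw [this]; exact hR)]; exact hs
    | succ N ih =>
      intro v h1 h2 h3
      rcases le_or_gt v (w * (3 / 2) ^ N) with h4 | h4
      · exact ih v h1 h2 h4
      · set u := w * (3 / 2) ^ N with hu
        have hwu : w ≤ u := le_mul_of_one_le_right hw.le (one_le_pow₀ (by norm_num))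
        have h3' : v ≤ u * (3 / 2) := by rw [hu, mul_assoc, ← pow_succ]; exact h3
        rw [← moveTo_moveTo R (c + v) (c + u) s]
        refine outcome_expand_of_lt_two_mul hM hT (w := u) (fun i hi => moveTo_of_mem hi)
          (fun i hi hi' => by rw [moveTo_of_notMem hi']; exact hc i hi hi')
          (ih u hwu (h4.trans h2) le_rfl) (by linarith) h4 (by linarith) h2
  obtain ⟨N, hN⟩ := pow_unbounded_of_one_lt (v / w) (by norm_num : (1 : ℝ) < 3 / 2)
  refine key N v hwv hv ?_
  rw [div_lt_iff₀ hw] at hN; linarith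

end expand

/-! ### Using the approximation guarantee -/

/-- The social cost of the outcome is at most `5 / 3` times the smallest social cost. -/
def FiveThirdsApprox {n : ℕ} (M : Mechanism n) : Prop :=
  ∀ (s : Instance n) (c : ℝ), totalDist s (M s) ≤ 5 / 3 * totalDist s c

lemma FiveThirdsApprox.sum_le {n : ℕ} {M : Mechanism n} (h : FiveThirdsApprox M) (s : Instance n)
    (c : ℝ) {l u : Fin n → ℝ} (hl : ∀ i, l i ≤ truncDist (s i) (M s))
    (hu : ∀ i, truncDist (s i) c ≤ u i) : ∑ i, l i ≤ 5 / 3 * ∑ i, u i := by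
  refine (Finset.sum_le_sum fun i _ => hl i).trans ((h s c).trans ?_)
  exact mul_le_mul_of_nonneg_left (Finset.sum_le_sum fun i _ => hu i) (by norm_num)

lemma sum_ite_mem_eq {n : ℕ} (T : Finset (Fin n)) (a b : ℝ) :
    ∑ i, (if i ∈ T then a else b) = T.card * a + (n - T.card) * b := by
  have : ∀ i, (if i ∈ T then a else b) = (if i ∈ T then a - b else 0) + b := by
    intro i; split_ifs <;> ring
  simp_rw [this, Finset.sum_add_distrib, Finset.sum_ite_mem, Finset.univ_inter, Finset.sum_const,
    Finset.card_univ, Fintype.card_fin, nsmul_eq_mul]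
  ring

lemma FiveThirdsApprox.card_le {n : ℕ} {M : Mechanism n} (h : FiveThirdsApprox M) (s : Instance n)
    (c : ℝ) (T : Finset (Fin n)) {a b a' b' : ℝ}
    (hl : ∀ i ∈ T, a ≤ truncDist (s i) (M s)) (hl' : ∀ i, i ∉ T → b ≤ truncDist (s i) (M s))
    (hu : ∀ i ∈ T, truncDist (s i) c ≤ a') (hu' : ∀ i, i ∉ T → truncDist (s i) c ≤ b') :
    T.card * a + (n - T.card) * b ≤ 5 / 3 * (T.card * a' + (n - T.card) * b') := by
  have := h.sum_le s c (l := fun i => if i ∈ T then a else b)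
    (u := fun i => if i ∈ T then a' else b')
    (fun i => by split_ifs with hi; exacts [hl i hi, hl' i hi])
    (fun i => by split_ifs with hi; exacts [hu i hi, hu' i hi])
  rwa [sum_ite_mem_eq, sum_ite_mem_eq] at this

lemma FiveThirdsApprox.unanimous {n : ℕ} (hn : 0 < n) {M : Mechanism n} (h : FiveThirdsApprox M)
    (x : ℝ) : M (fun _ => x) = x := by
  have h1 := h (fun _ => x) x
  simp only [totalDist, truncDist_self, Finset.sum_const_zero, mul_zero, Finset.sum_const,
    Finset.card_univ, Fintype.card_fin, nsmul_eq_mul] at h1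
  have h2 : truncDist x (M fun _ => x) ≤ 0 := by
    by_contra! h3
    have : (0 : ℝ) < n := by exact_mod_cast hn
    nlinarith
  have h3 := abs_le_of_truncDist_le (x' := 0) (c' := 0)
    (h2.trans (truncDist_nonneg 0 0)) (by simp)
  simp only [sub_self, abs_zero, abs_nonpos_iff] at h3
  linarith

lemma le_truncDist_of_le {x c a : ℝ} (h1 : a ≤ 1) (h : a ≤ x - c) : a ≤ truncDist x c :=
  le_min h1 (h.trans (le_abs_self _))

section spread

variable {n : ℕ} {M : Mechanism n} {T R : Finset (Fin n)} {s : Instance n} {c : ℝ}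

/-- If the outcome moves left by less than 99/100, `R` can return to `c` without affecting it, and
the agents moved so far can join it: a decisive subset of `T`. If it moves farther, the majority
outside `T` pays almost 1 and the ratio fails. -/
lemma outcome_spread_half (hM : Truthful M) (hA : FiveThirdsApprox M)
    (hT : ∀ S ⊆ T, ¬ Decisive M S) (hcard : 2 * T.card + 1 ≤ n) (hTR : ∀ i ∈ R, i ∉ T)
    (hR : ∀ i ∈ R, s i = c + 1 / 100) (hc : ∀ i, i ∉ R → s i = c) (hs : M s = c) :
    M (moveTo T (c - 1 / 2) s) = c := by
  have hcard' : 2 * (T.card : ℝ) + 1 ≤ n := by exact_mod_cast hcard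
  refine moveTo_induction (fun t => M t = c) T (c - 1 / 2) s hs fun B hB i hi hiB h => ?_
  have h2 := hM.le_after (moveTo B (c - 1 / 2) s) i (c - 1 / 2)
  rw [h] at h2
  rw [← moveTo_insert] at h2 ⊢
  have hBT : insert i B ⊆ T := Finset.insert_subset hi hB
  set t := moveTo (insert i B) (c - 1 / 2) s with ht
  have h3 := abs_le_of_truncDist_le h2 (by rw [abs_of_neg] <;> linarith)
  rw [abs_of_neg (by linarith : c - 1 / 2 - c < 0), abs_le] at h3
  by_contra hne
  have hlt : M t < c := lt_of_le_of_ne (by linarith) hne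
  have htR : ∀ j ∈ R, t j = c + 1 / 100 := fun j hj => by
    rw [ht, moveTo_of_notMem fun h => hTR j hj (hBT h)]; exact hR j hj
  have htc : ∀ j, j ∉ insert i B → j ∉ R → t j = c := fun j hj hj' => by
    rw [ht, moveTo_of_notMem hj]; exact hc j hj'
  rcases lt_or_ge (c - 99 / 100) (M t) with hfar | hnear
  · have h4 := hM.moveTo_toward (A := R) (q := c) rfl hlt
      (fun j hj => by rw [htR j hj]; constructor <;> linarith)
    have h5 := hM.moveTo_outcome (insert i B) h4
    refine hT _ hBT ⟨M t, c, hne, by rw [abs_lt]; constructor <;> linarith, ?_⟩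
    convert h5 using 2
    ext j
    by_cases hj : j ∈ insert i B
    · rw [moveTo_of_mem hj, moveTo_of_mem hj]
    · rw [moveTo_of_notMem hj, moveTo_of_notMem hj]
      by_cases hjR : j ∈ R
      · rw [moveTo_of_mem hjR]
      · rw [moveTo_of_notMem hjR, htc j hj hjR]
  · have h4 := hA.card_le t c T (a := 49 / 100) (b := 99 / 100) (a' := 1 / 2) (b' := 1 / 100)
      (fun j hj => by
        apply le_truncDist_of_le (by norm_num)
        by_cases hj' : j ∈ insert i B
        · rw [ht, moveTo_of_mem hj', ← ht]; linarith
        · rw [htc j hj' fun h => hTR j h hj]; linarith)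
      (fun j hj => by
        apply le_truncDist_of_le (by norm_num)
        by_cases hj' : j ∈ R
        · rw [htR j hj']; linarith
        · rw [htc j (fun h => hj (hBT h)) hj']; linarith)
      (fun j hj => by
        refine (truncDist_le_abs _ _).trans ?_
        by_cases hj' : j ∈ insert i B
        · rw [ht, moveTo_of_mem hj', abs_le]; constructor <;> linarith
        · rw [htc j hj' fun h => hTR j h hj, abs_le]; constructor <;> linarith)
      (fun j hj => by
        refine (truncDist_le_abs _ _).trans ?_
        by_cases hj' : j ∈ R
        · rw [htR j hj', abs_le]; constructor <;> linarith
        · rw [htc j (fun h => hj (hBT h)) hj', abs_le]; constructor <;> linarith)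
    linarith [(Nat.cast_nonneg T.card : (0 : ℝ) ≤ T.card)]

/-- If the outcome leaves `c`, it lands at or left of `c - 2y`. Since `2y ≥ 1`, everybody outside
`T` then pays 1. `hslack` is the violated ratio for one agent of `T` paired with one outside; the
pairing exists because `T` is a minority. -/
lemma outcome_spread (hM : Truthful M) (hA : FiveThirdsApprox M) (hcard : 2 * T.card + 1 ≤ n)
    (hR : ∀ i ∈ R, s i = c + 1 / 100)
    (hc : ∀ i, i ∉ T → i ∉ R → s i = c) {y y' : ℝ} (hTy : ∀ i ∈ T, s i = c - y) (hs : M s = c)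
    (hy : 1 / 2 ≤ y) (hyy' : y < y') (hy' : y' < 1)
    (hslack : 1 / 60 + 5 / 3 * y' < 1 + 2 * y - y') :
    M (moveTo T (c - y') s) = c := by
  have hcard' : 2 * (T.card : ℝ) + 1 ≤ n := by exact_mod_cast hcard
  refine moveTo_induction (fun t => M t = c) T (c - y') s hs fun B hB i hi hiB h => ?_
  have h1 := hM.le_before (moveTo B (c - y') s) i (c - y')
  have h2 := hM.le_after (moveTo B (c - y') s) i (c - y')
  rw [h] at h1 h2
  rw [moveTo_of_notMem hiB, hTy i hi] at h1
  rw [← moveTo_insert] at h1 h2 ⊢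
  have hBT : insert i B ⊆ T := Finset.insert_subset hi hB
  set t := moveTo (insert i B) (c - y') s with ht
  have h3 := abs_le_of_truncDist_le h2 (by rw [abs_of_neg] <;> linarith)
  rw [abs_of_neg (by linarith : c - y' - c < 0), abs_le] at h3
  by_contra hne
  have hlt : M t < c := lt_of_le_of_ne (by linarith) hne
  have hle : M t ≤ c - 2 * y := by
    by_contra! hlt'
    have : |c - y - M t| < y := by rw [abs_lt]; constructor <;> linarith
    refine absurd (truncDist_lt_truncDist ?_ (this.trans (by linarith))) (not_lt.2 h1)
    rwa [show c - y - c = -y by ring, abs_neg, abs_of_pos (by linarith : 0 < y)]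
  have h4 := hA.card_le t c T (a := 2 * y - y') (b := 1) (a' := y') (b' := 1 / 100)
    (fun j hj => by
      apply le_truncDist_of_le (by linarith)
      by_cases hj' : j ∈ insert i B
      · rw [ht, moveTo_of_mem hj', ← ht]; linarith
      · rw [show t j = c - y by rw [ht, moveTo_of_notMem hj']; exact hTy j hj]; linarith)
    (fun j hj => by
      apply le_truncDist_of_le le_rfl
      rw [show t j = s j from moveTo_of_notMem fun h => hj (hBT h)]
      by_cases hj' : j ∈ R
      · rw [hR j hj']; linarith
      · rw [hc j hj hj']; linarith)
    (fun j hj => by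
      refine (truncDist_le_abs _ _).trans ?_
      by_cases hj' : j ∈ insert i B
      · rw [ht, moveTo_of_mem hj', abs_le]; constructor <;> linarith
      · rw [show t j = c - y by rw [ht, moveTo_of_notMem hj']; exact hTy j hj, abs_le]
        constructor <;> linarith)
    (fun j hj => by
      refine (truncDist_le_abs _ _).trans ?_
      rw [show t j = s j from moveTo_of_notMem fun h => hj (hBT h)]
      by_cases hj' : j ∈ R
      · rw [hR j hj', abs_le]; constructor <;> linarith
      · rw [hc j hj hj', abs_le]; constructor <;> linarith)
  have h5 := mul_nonneg (Nat.cast_nonneg T.card : (0 : ℝ) ≤ T.card) (sub_nonneg.2 hslack.le)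
  linarith

end spread

/-! ### Size of a smallest decisive coalition -/

lemma card_bound_of_decisive_right {n : ℕ} (hn : 0 < n) {M : Mechanism n} (hM : Truthful M)
    (hA : FiveThirdsApprox M) {S : Finset (Fin n)}
    (hmin : ∀ S' : Finset (Fin n), S'.card < S.card → ¬ Decisive M S')
    (hcard : 2 * S.card ≤ n + 1) {c q : ℝ} (hcq : c < q) (hq : q < c + 1)
    (hS : M (moveTo S c fun _ => q) = c) : 99 / 100 * ((n : ℝ) - 1) ≤ 5 / 3 * S.card := by
  have hne : S.Nonempty := by
    rw [Finset.nonempty_iff_ne_empty]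
    rintro rfl
    have h := hA.unanimous hn q
    rw [show moveTo ∅ c (fun _ => q) = fun _ : Fin n => q by ext; simp [moveTo], h] at hS
    exact hcq.ne' hS
  obtain ⟨i₀, hi₀⟩ := hne
  set T := S.erase i₀ with hTdef
  set R := Sᶜ with hRdef
  have hTcard : T.card + 1 = S.card := Finset.card_erase_add_one hi₀
  have hTR : ∀ i ∈ R, i ∉ T := fun i hi h =>
    Finset.mem_compl.1 hi (Finset.mem_of_mem_erase h)
  have hi₀T : i₀ ∉ T := Finset.notMem_erase _ _
  have hi₀R : i₀ ∉ R := fun h => Finset.mem_compl.1 h hi₀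
  have hsub : ∀ S' ⊆ T, ¬ Decisive M S' := fun S' h => hmin S' (by
    have := Finset.card_le_card h; omega)
  have hTdec := hsub T subset_rfl
  have hrest : ∀ i, i ∉ T → i ∉ R → i = i₀ := by
    intro i h1 h2
    by_contra h
    exact h1 (Finset.mem_erase.2 ⟨h, by simpa [hRdef] using h2⟩)
  set s₀ := moveTo S c fun _ => q with hs₀
  have hs₀c : ∀ i, i ∉ R → s₀ i = c := fun i hi => moveTo_of_mem (by simpa [hRdef] using hi)
  have hs₀R : ∀ i ∈ R, s₀ i = q := fun i hi => moveTo_of_notMem (Finset.mem_compl.1 hi)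
  set s₁ := moveTo R (c + 1 / 100) s₀ with hs₁
  have hs₁R : ∀ i ∈ R, s₁ i = c + 1 / 100 := fun i hi => moveTo_of_mem hi
  have hs₁c : ∀ i, i ∉ R → s₁ i = c := fun i hi => by
    rw [hs₁, moveTo_of_notMem hi, hs₀c i hi]
  have hM₁ : M s₁ = c := by
    -- The complement is brought to `c + 1 / 100`, outwards or inwards as needed.
    rcases le_or_gt q (c + 1 / 100) with h | h
    · exact outcome_expand hM hTdec (w := q - c) (fun i hi => by rw [hs₀R i hi]; ring)
        (fun i _ hi => hs₀c i hi) hS (by linarith) (by linarith) (by norm_num)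
    · exact hM.moveTo_toward hS (by linarith) fun i hi => by rw [hs₀R i hi]; exact ⟨h, hq⟩
  have hM₂ := outcome_spread_half hM hA hsub (by omega) hTR hs₁R hs₁c hM₁
  have step : ∀ y y' : ℝ, 1 / 2 ≤ y → y < y' → y' < 1 →
      1 / 60 + 5 / 3 * y' < 1 + 2 * y - y' →
      M (moveTo T (c - y) s₁) = c → M (moveTo T (c - y') s₁) = c := by
    intro y y' h1 h2 h3 h4 h5
    rw [← moveTo_moveTo T _ (c - y)]
    exact outcome_spread hM hA (by omega)
      (fun i hi => by rw [moveTo_of_notMem (hTR i hi)]; exact hs₁R i hi)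
      (fun i hi hi' => by rw [moveTo_of_notMem hi]; exact hs₁c i hi')
      (fun i hi => moveTo_of_mem hi) h5 h1 h2 h3 h4
  -- `hslack` amounts to `y' < (3 / 8) * (59 / 60 + 2 * y)`; from 1/2 this allows 7/10, then 22/25,
  -- then 99/100.
  have hM₃ := step _ (7 / 10) (by norm_num) (by norm_num) (by norm_num) (by norm_num) hM₂
  have hM₄ := step _ (22 / 25) (by norm_num) (by norm_num) (by norm_num) (by norm_num) hM₃
  have hM₅ := step _ (99 / 100) (by norm_num) (by norm_num) (by norm_num) (by norm_num) hM₄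
  set s₂ := moveTo T (c - 99 / 100) s₁ with hs₂
  have hM₆ := outcome_expand hM hTdec (s := s₂) (w := 1 / 100) (v := 99 / 100)
    (fun i hi => by rw [hs₂, moveTo_of_notMem (hTR i hi)]; exact hs₁R i hi)
    (fun i hi hi' => by rw [hs₂, moveTo_of_notMem hi]; exact hs₁c i hi')
    hM₅ (by norm_num) (by norm_num) (by norm_num)
  set s₃ := moveTo R (c + 99 / 100) s₂ with hs₃
  have hs₃R : ∀ i ∈ R, s₃ i = c + 99 / 100 := fun i hi => moveTo_of_mem hi
  have hs₃T : ∀ i ∈ T, s₃ i = c - 99 / 100 := fun i hi => by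
    rw [hs₃, moveTo_of_notMem fun h => hTR i h hi]; exact moveTo_of_mem hi
  -- All but `i₀` are 99/100 away from the outcome `c`; at `c + 99 / 100` only `S` pays.
  have h := hA.sum_le s₃ (c + 99 / 100)
    (l := fun i => if i ∈ ({i₀} : Finset _) then 0 else 99 / 100)
    (u := fun i => if i ∈ S then 1 else 0)
    (fun i => by
      split_ifs with hi
      · exact truncDist_nonneg _ _
      · rw [hM₆]
        by_cases hiR : i ∈ R
        · rw [hs₃R i hiR]; exact le_truncDist_of_le (by norm_num) (by linarith)
        · have hiT : i ∈ T := by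
            by_contra hiT
            exact hi (Finset.mem_singleton.2 (hrest i hiT hiR))
          rw [hs₃T i hiT, truncDist_comm]; exact le_truncDist_of_le (by norm_num) (by linarith))
    (fun i => by
      split_ifs with hi
      · exact truncDist_le_one _ _
      · rw [hs₃R i (Finset.mem_compl.2 hi), truncDist_self])
  rw [sum_ite_mem_eq, sum_ite_mem_eq, Finset.card_singleton] at h
  push_cast at h
  linarith

/-- The mirror image of a mechanism. -/
def reflect {n : ℕ} (M : Mechanism n) : Mechanism n := fun s => -M fun i => -s i

lemma Truthful.reflect {n : ℕ} {M : Mechanism n} (hM : Truthful M) : Truthful (reflect M) := by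
  rw [truthful_iff] at hM ⊢
  intro s i s'
  have := hM (fun j => -s j) i (-s')
  rw [← truncDist_neg, ← truncDist_neg (-s i)] at this
  simp only [neg_neg] at this
  have e : (fun j => -Function.update s i s' j) = Function.update (fun j => -s j) i (-s') := by
    ext j
    rcases eq_or_ne j i with rfl | h
    · simp
    · simp [h]
  simpa only [TIC.reflect, e] using this

lemma FiveThirdsApprox.reflect {n : ℕ} {M : Mechanism n} (hM : FiveThirdsApprox M) :
    FiveThirdsApprox (reflect M) := by
  intro s c
  have := hM (fun j => -s j) (-c)
  rw [totalDist_neg] at this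
  rwa [← totalDist_neg, TIC.reflect, neg_neg]

lemma reflect_moveTo {n : ℕ} (M : Mechanism n) (S : Finset (Fin n)) (c q : ℝ) :
    reflect M (moveTo S c fun _ => q) = -M (moveTo S (-c) fun _ => -q) := by
  unfold reflect
  congr 2
  ext i
  by_cases hi : i ∈ S <;> simp [moveTo, hi]

lemma decisive_of_reflect {n : ℕ} {M : Mechanism n} {S : Finset (Fin n)}
    (h : Decisive (reflect M) S) : Decisive M S := by
  obtain ⟨c, q, h1, h2, h3⟩ := h
  rw [reflect_moveTo] at h3
  refine ⟨-c, -q, fun h => h1 (neg_injective h), ?_, by linarith⟩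
  rwa [← abs_neg, show -(-c - -q) = c - q by ring]

lemma card_bound_of_decisive {n : ℕ} (hn : 0 < n) {M : Mechanism n} (hM : Truthful M)
    (hA : FiveThirdsApprox M) {S : Finset (Fin n)}
    (hmin : ∀ S' : Finset (Fin n), S'.card < S.card → ¬ Decisive M S')
    (hcard : 2 * S.card ≤ n + 1) (hS : Decisive M S) :
    99 / 100 * ((n : ℝ) - 1) ≤ 5 / 3 * S.card := by
  obtain ⟨c, q, h1, h2, h3⟩ := hS
  rw [abs_lt] at h2
  rcases lt_or_gt_of_ne h1 with h | h
  · exact card_bound_of_decisive_right hn hM hA hmin hcard h (by linarith) h3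
  · refine card_bound_of_decisive_right hn hM.reflect hA.reflect
      (fun S' hS' h => hmin S' hS' (decisive_of_reflect h)) hcard (c := -c) (q := -q)
      (by linarith) (by linarith) ?_
    rw [reflect_moveTo, neg_neg, neg_neg, h3]

/-- Split the agents evenly between 0 and 1/2. If 1/2 wins, its supporters are decisive. Otherwise
the ratio keeps the outcome within 1 of 1/2, and the agents at 0 can join it. -/
lemma exists_decisive_card_le {n : ℕ} (hn : 0 < n) {M : Mechanism n} (hM : Truthful M)
    (hA : FiveThirdsApprox M) : ∃ S : Finset (Fin n), Decisive M S ∧ S.card ≤ n - n / 2 := by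
  obtain ⟨A, -, hAcard⟩ := Finset.exists_subset_card_eq (s := (Finset.univ : Finset (Fin n)))
    (n := n / 2) (by simp; omega)
  set s := moveTo A 0 fun _ => (1 / 2 : ℝ) with hs
  have hsA : ∀ i ∈ A, s i = 0 := fun i hi => moveTo_of_mem hi
  have hsA' : ∀ i, i ∉ A → s i = 1 / 2 := fun i hi => moveTo_of_notMem hi
  by_cases hc : M s = 1 / 2
  · refine ⟨Aᶜ, ⟨1 / 2, 0, by norm_num, by rw [abs_lt]; norm_num, ?_⟩, ?_⟩
    · convert hc using 2
      ext i
      by_cases hi : i ∈ A <;> simp [moveTo, hs, hi]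
    · rw [Finset.card_compl, hAcard, Fintype.card_fin]
  · refine ⟨A, ⟨M s, 1 / 2, hc, ?_, ?_⟩, by omega⟩
    · by_contra! hfar
      have h := hA.card_le s (1 / 2) A (a := 1 / 2) (b := 1) (a' := 1 / 2) (b' := 0)
        (fun i hi => by
          rw [hsA i hi]
          refine le_min (by norm_num) ?_
          rcases le_abs.1 hfar with h | h
          · exact le_abs.2 (Or.inr (by linarith))
          · exact le_abs.2 (Or.inl (by linarith)))
        (fun i hi => by
          rw [hsA' i hi]
          exact le_min le_rfl (by rwa [abs_sub_comm]))
        (fun i hi => by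
          rw [hsA i hi]
          exact (truncDist_le_abs _ _).trans (by rw [abs_le]; norm_num))
        (fun i hi => by rw [hsA' i hi, truncDist_self])
      have h1 : 2 * (A.card : ℝ) ≤ n := by
        rw [hAcard]; exact_mod_cast Nat.mul_div_le n 2
      have h2 : (0 : ℝ) < n := by exact_mod_cast hn
      linarith
    · convert hM.moveTo_outcome A (s := s) rfl using 2
      rw [hs, moveTo_moveTo]

lemma not_fiveThirdsApprox {n : ℕ} (hn : (Even n ∧ 6 < n) ∨ 11 < n) {M : Mechanism n}
    (hM : Truthful M) : ¬ FiveThirdsApprox M := by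
  classical
  intro hA
  have hn0 : 0 < n := by omega
  obtain ⟨S₀, hS₀, hS₀card⟩ := exists_decisive_card_le hn0 hM hA
  obtain ⟨S, hS, hmin⟩ := Finset.exists_min_image (Finset.univ.filter (Decisive M)) Finset.card
    ⟨S₀, Finset.mem_filter.2 ⟨Finset.mem_univ _, hS₀⟩⟩
  have hSS₀ := hmin S₀ (Finset.mem_filter.2 ⟨Finset.mem_univ _, hS₀⟩)
  have h := card_bound_of_decisive hn0 hM hA (S := S)
    (fun S' hlt hS' => absurd (hmin S' (Finset.mem_filter.2 ⟨Finset.mem_univ _, hS'⟩))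
      (not_le.2 hlt)) (by omega) (Finset.mem_filter.1 hS).2
  have hbound : 297 * n ≤ 500 * S.card + 297 := by
    have : (297 : ℝ) * n ≤ 500 * S.card + 297 := by linarith
    exact_mod_cast this
  -- With |S| ≤ ⌈n/2⌉, `hbound` gives 94m ≤ 297 for n = 2m and 94m ≤ 500 for n = 2m + 1, that is, n
  -- ≤ 6 or n ≤ 11.
  rcases hn with ⟨⟨m, rfl⟩, hm⟩ | hn
  · omega
  · omega

lemma fiveThirdsApprox_of_approxRatio_le {n : ℕ} {M : Mechanism n}
    (h : approxRatio M ≤ 5 / 3) : FiveThirdsApprox M := by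
  intro s c
  have h1 : socialCost s (M s) / optCost s ≤ 5 / 3 := (le_iSup _ s).trans h
  have hlt : (5 / 3 : ℝ≥0∞) = ENNReal.ofReal (5 / 3) := by
    rw [ENNReal.ofReal_div_of_pos (by norm_num)]; simp
  -- As 5/3 is neither 0 nor ∞, this covers a zero optimum too, as `FiveThirdsApprox.unanimous`
  -- requires.
  have h2 : socialCost s (M s) ≤ 5 / 3 * optCost s :=
    (ENNReal.div_le_iff_le_mul (Or.inr (by simp [hlt])) (Or.inr (by simp [hlt]))).1 h1
  have h3 : socialCost s (M s) ≤ 5 / 3 * socialCost s c :=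
    h2.trans (mul_le_mul_right (iInf_le _ c) _)
  rw [socialCost_eq, socialCost_eq, hlt, ← ENNReal.ofReal_mul (by norm_num)] at h3
  exact (ENNReal.ofReal_le_ofReal_iff
    (mul_nonneg (by norm_num) (totalDist_nonneg s c))).1 h3

end TIC

theorem theorem6 (n : ℕ) (hn : 0 < n) :
    TIC.UniversallyTruthful (TIC.uniformStatistic n hn) ∧
    TIC.randomizedApproxRatio (TIC.uniformStatistic n hn) ≤ 5 / 3 ∧
    ((Even n ∧ 6 < n) ∨ 11 < n →
      ∀ M : TIC.Mechanism n, TIC.Truthful M → 5 / 3 < TIC.approxRatio M) :=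
  ⟨TIC.uniformStatistic_universallyTruthful n hn,
    TIC.randomizedApproxRatio_uniformStatistic_le n hn, fun h _ hM =>
      lt_of_not_ge fun hle =>
        TIC.not_fiveThirdsApprox h hM (TIC.fiveThirdsApprox_of_approxRatio_le hle)⟩
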